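/- Conventions. Let $(M,g,J)$ be an almost Hermitian manifold of real dimension $2m$ (a smooth manifold with a smooth Riemannian metric $g$ and a smooth field $J$ of endomorphisms of the tangent spaces with $J^2=-1$ and $g(JX,JY)=g(X,Y)$). Let $\nabla$ be its Levi-Civita connection, $R(X,Y)=\nabla_{[X,Y]}-[\nabla_X,\nabla_Y]$ and $R(X,Y,Z,U)=g(R(X,Y)Z,U)$. For orthonormal $X,Y\in T_pM$ let $K(X,Y)=R(X,Y,X,Y)$ be the sectional curvature of their span, and for all $X,Y\in T_pM$ let $\lambda(X,Y)=R(X,Y,X,Y)-R(X,Y,JX,JY)$. A two-dimensional subspace $\sigma\subset T_pM$ is anti-holomorphic if $J\sigma\perp\sigma$. A co-holomorphic $(2n+1)$-plane is a $(2n+1)$-dimensional subspace of $T_pM$ that contains a $2n$-dimensional subspace $\tau$ with $J\tau=\tau$. $M$ satisfies the axiom of co-holomorphic $(2n+1)$-spheres if for each $p\in M$ and each co-holomorphic $(2n+1)$-plane $\sigma\subset T_pM$ there is a $(2n+1)$-dimensional (immersed) totally umbilical submanifold $N$ of $M$ with $p\in N$ and $T_pN=\sigma$; here $N$ is totally umbilical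 if its second fundamental form is $h(X,Y)=g(X,Y)\eta$ for a normal vector field $\eta$. $M$ has pointwise constant type if for all $p\in M$ and all $X,Y,Z\in T_pM$ such that $\mathrm{span}\{X,Y\}$ and $\mathrm{span}\{X,Z\}$ are anti-holomorphic planes, $g(X,Y)=g(X,Z)=0$ and $g(Y,Y)=g(Z,Z)$, one has $\lambda(X,Y)=\lambda(X,Z)$. For a function $\alpha:M\to\mathbb R$, it has pointwise constant type $\alpha$ if moreover $\lambda(X,Y)=\alpha(p)$ for all $p$ and all orthonormal $X,Y\in T_pM$ that span an anti-holomorphic plane. $M$ has pointwise constant anti-holomorphic sectional curvature if at each $p\in M$ all anti-holomorphic planes in $T_pM$ have the same sectional curvature, and pointwise constant anti-holomorphic sectional curvature $\alpha$ if that value is $\alpha(p)$ for every $p$. Theorem 4.1. Let $M$ be an almost Hermitian manifold of dimension $2m\ge 6$ that satisfies the axiom of co-holomorphic $(2n+1)$-spheres for some $n$ with $1\le n\le m-1$. Then $M$ has pointwise constant type if and only if $M$ has pointwise constant anti-holomorphic sectional curvature; and for every function $\alpha:M\to\mathbb R$, $M$ has pointwise constant type $\alpha$ if and only if $M$ has pointwise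 constant anti-holomorphic sectional curvature $\alpha$. -/

import Mathlib

open scoped Manifold ContDiff Bundle

noncomputable section

/-! ### Riemannian geometry of a metric on an open part of a vector space

A metric is given by its coefficients `G x u v`, where `x` is the point and `u`, `v` are vectors. -/

namespace CoordMetric

variable {E : Type*} [NormedAddCommGroup E] [NormedSpace ℝ E]
variable {E' : Type*} [NormedAddCommGroup E'] [NormedSpace ℝ E']

/-- The covector `w ↦ ½ (D_u G(v, w) + D_v G(u, w) - D_w G(u, v))` at `x`
(Christoffel symbols of the first kind). -/
def christoffelLower (G : E → E →L[ℝ] E →L[ℝ] ℝ) (x u v : E) : E →L[ℝ] ℝ :=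
  (1 / 2 : ℝ) • (fderiv ℝ G x u v + fderiv ℝ G x v u - ((fderiv ℝ G x).flip u).flip v)

/-- The Christoffel symbols of the second kind (of the Levi-Civita connection `∇` of `G`): the
vector `Γ_x(u, v)` with `G x (Γ_x(u, v)) w = ½ (D_u G(v, w) + D_v G(u, w) - D_w G(u, v))`
for all `w`, so that `∇_u V = D_u V + Γ(u, V)`. -/
def christoffel (G : E → E →L[ℝ] E →L[ℝ] ℝ) (x u v : E) : E :=
  (G x).inverse (christoffelLower G x u v)

/-- The curvature operator with the sign convention `R(U, V) = ∇_[U, V] - [∇_U, ∇_V]`. -/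
def curvatureOp (G : E → E →L[ℝ] E →L[ℝ] ℝ) (x u v w : E) : E :=
  -(fderiv ℝ (fun y ↦ christoffel G y v w) x u - fderiv ℝ (fun y ↦ christoffel G y u w) x v
    + christoffel G x u (christoffel G x v w) - christoffel G x v (christoffel G x u w))

/-- The covariant derivative `∇_a (F_* b)` at `y`, along a map `F` into `(E, G)`, of the image
`F_* b` of the constant vector field `b`: this is `D²F(a, b) + Γ(DF a, DF b)`. -/
def covDerivAlong (G : E → E →L[ℝ] E →L[ℝ] ℝ) (F : E' → E) (y a b : E') : E :=
  fderiv ℝ (fderiv ℝ F) y a b + christoffel G (F y) (fderiv ℝ F y a) (fderiv ℝ F y b)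

end CoordMetric

/-- An almost Hermitian structure on a smooth manifold `M` modelled on `E`: a smooth Riemannian
metric `g` and a smooth field `J` of endomorphisms of the tangent spaces such that `J² = -1` and
`g(JX, JY) = g(X, Y)`. -/
structure AlmostHermitianStructure (E : Type*) [NormedAddCommGroup E] [NormedSpace ℝ E]
    (M : Type*) [TopologicalSpace M] [ChartedSpace E M] [IsManifold 𝓘(ℝ, E) ∞ M] where
  g : Bundle.ContMDiffRiemannianMetric 𝓘(ℝ, E) ∞ E (fun x : M ↦ TangentSpace 𝓘(ℝ, E) x)
  J : ∀ x : M, TangentSpace 𝓘(ℝ, E) x →L[ℝ] TangentSpace 𝓘(ℝ, E) x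
  contMDiff_J : ContMDiff 𝓘(ℝ, E) (𝓘(ℝ, E).prod 𝓘(ℝ, E →L[ℝ] E)) ∞
    (fun x ↦ Bundle.TotalSpace.mk' (E →L[ℝ] E)
      (E := fun x : M ↦ TangentSpace 𝓘(ℝ, E) x →L[ℝ] TangentSpace 𝓘(ℝ, E) x) x (J x))
  J_J : ∀ (x : M) (v : TangentSpace 𝓘(ℝ, E) x), J x (J x v) = -v
  inner_J_J : ∀ (x : M) (v w : TangentSpace 𝓘(ℝ, E) x),
    g.inner x (J x v) (J x w) = g.inner x v w

namespace AlmostHermitianStructure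

variable {E : Type*} [NormedAddCommGroup E] [NormedSpace ℝ E]
  {M : Type*} [TopologicalSpace M] [ChartedSpace E M] [IsManifold 𝓘(ℝ, E) ∞ M]
  (S : AlmostHermitianStructure E M)

/-! ### Curvature -/

/-- The coefficients of the metric in the chart `c` (meaningful on `c.target`):
`G x u v = g(D(c⁻¹)_x u, D(c⁻¹)_x v)`. -/
def metricInChart (c : OpenPartialHomeomorph M E) (x : E) : E →L[ℝ] E →L[ℝ] ℝ :=
  let A : E →L[ℝ] E := mfderiv 𝓘(ℝ, E) 𝓘(ℝ, E) c.symm x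
  let B : E →L[ℝ] E →L[ℝ] ℝ := S.g.inner (c.symm x)
  B.bilinearComp A A

theorem metricInChart_apply (c : OpenPartialHomeomorph M E) (x u v : E) :
    S.metricInChart c x u v =
      S.g.inner (c.symm x) (mfderiv 𝓘(ℝ, E) 𝓘(ℝ, E) c.symm x u)
        (mfderiv 𝓘(ℝ, E) 𝓘(ℝ, E) c.symm x v) := rfl

/-- The Riemann curvature tensor `R(X, Y, Z, U) = g(R(X, Y)Z, U)` of the Levi-Civita connection at
the point `p`, where `R(X, Y) = ∇_[X, Y] - [∇_X, ∇_Y]`. It is computed in the preferred chart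
at `p`. -/
def curvature (p : M) (X Y Z U : TangentSpace 𝓘(ℝ, E) p) : ℝ :=
  let c := chartAt E p
  let d : TangentSpace 𝓘(ℝ, E) p →L[ℝ] E := mfderiv 𝓘(ℝ, E) 𝓘(ℝ, E) c p
  let G := S.metricInChart c
  G (c p) (CoordMetric.curvatureOp G (c p) (d X) (d Y) (d Z)) (d U)

/-- `K(X, Y) = R(X, Y, X, Y)`, for orthonormal `X`, `Y` the sectional curvature of their span. -/
def sectional (p : M) (X Y : TangentSpace 𝓘(ℝ, E) p) : ℝ :=
  S.curvature p X Y X Y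

/-- `λ(X, Y) = R(X, Y, X, Y) - R(X, Y, JX, JY)`. -/
def lam (p : M) (X Y : TangentSpace 𝓘(ℝ, E) p) : ℝ :=
  S.curvature p X Y X Y - S.curvature p X Y (S.J p X) (S.J p Y)

/-- `X` and `Y` are orthonormal tangent vectors at `p`. -/
def IsOrthonormalPair (p : M) (X Y : TangentSpace 𝓘(ℝ, E) p) : Prop :=
  S.g.inner p X X = 1 ∧ S.g.inner p Y Y = 1 ∧ S.g.inner p X Y = 0

/-! ### Planes in a tangent space -/

/-- An anti-holomorphic plane: a two-dimensional subspace `σ` with `Jσ ⟂ σ`. -/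
def IsAntiholomorphicPlane (p : M) (σ : Submodule ℝ (TangentSpace 𝓘(ℝ, E) p)) : Prop :=
  Module.finrank ℝ σ = 2 ∧ ∀ v ∈ σ, ∀ w ∈ σ, S.g.inner p (S.J p v) w = 0

/-- A holomorphic `k`-plane: a `k`-dimensional subspace `τ` with `Jτ = τ`. -/
def IsHolomorphicPlane (k : ℕ) (p : M) (τ : Submodule ℝ (TangentSpace 𝓘(ℝ, E) p)) : Prop :=
  Module.finrank ℝ τ = k ∧ τ.map (S.J p : TangentSpace 𝓘(ℝ, E) p →ₗ[ℝ] TangentSpace 𝓘(ℝ, E) p) = τ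

/-- A co-holomorphic `(2n+1)`-plane: a `(2n+1)`-dimensional subspace containing a holomorphic
`2n`-plane. -/
def IsCoholomorphicPlane (n : ℕ) (p : M) (σ : Submodule ℝ (TangentSpace 𝓘(ℝ, E) p)) : Prop :=
  Module.finrank ℝ σ = 2 * n + 1 ∧ ∃ τ ≤ σ, S.IsHolomorphicPlane (2 * n) p τ

/-! ### Constant type and constant anti-holomorphic sectional curvature -/

/-- Constant type at `p`: `λ(X, Y) = λ(X, Z)` whenever `Y` and `Z` have the same length, are
orthogonal to `X`, and span anti-holomorphic planes with `X`. -/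
def IsConstantTypeAt (p : M) : Prop :=
  ∀ X Y Z : TangentSpace 𝓘(ℝ, E) p,
    S.IsAntiholomorphicPlane p (Submodule.span ℝ {X, Y}) →
    S.IsAntiholomorphicPlane p (Submodule.span ℝ {X, Z}) →
    S.g.inner p X Y = 0 → S.g.inner p X Z = 0 →
    S.g.inner p Y Y = S.g.inner p Z Z → S.lam p X Y = S.lam p X Z

/-- Pointwise constant type. -/
def IsPointwiseConstantType : Prop := ∀ p : M, S.IsConstantTypeAt p

/-- Pointwise constant type `α`: pointwise constant type, where `α p` is the value at `p` of `λ` on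
the orthonormal pairs that span an anti-holomorphic plane. -/
def IsPointwiseConstantTypeWith (α : M → ℝ) : Prop :=
  S.IsPointwiseConstantType ∧
  ∀ (p : M) (X Y : TangentSpace 𝓘(ℝ, E) p),
    S.IsAntiholomorphicPlane p (Submodule.span ℝ {X, Y}) → S.IsOrthonormalPair p X Y →
    S.lam p X Y = α p

/-- Pointwise constant anti-holomorphic sectional curvature: at each point `p`, the sectional
curvature is the same for all anti-holomorphic planes. -/
def IsPointwiseConstantAntiholomorphic : Prop :=
  ∀ (p : M) (σ σ' : Submodule ℝ (TangentSpace 𝓘(ℝ, E) p)),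
    S.IsAntiholomorphicPlane p σ → S.IsAntiholomorphicPlane p σ' →
    ∀ X ∈ σ, ∀ Y ∈ σ, ∀ X' ∈ σ', ∀ Y' ∈ σ',
      S.IsOrthonormalPair p X Y → S.IsOrthonormalPair p X' Y' →
      S.sectional p X Y = S.sectional p X' Y'

/-- Pointwise constant anti-holomorphic sectional curvature `α`: at each point `p`, all
anti-holomorphic planes have sectional curvature `α p`. -/
def IsPointwiseConstantAntiholomorphicWith (α : M → ℝ) : Prop :=
  ∀ (p : M) (σ : Submodule ℝ (TangentSpace 𝓘(ℝ, E) p)), S.IsAntiholomorphicPlane p σ →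
    ∀ X ∈ σ, ∀ Y ∈ σ, S.IsOrthonormalPair p X Y → S.sectional p X Y = α p

/-! ### Submanifolds -/

section Submanifold

variable {E' : Type*} [NormedAddCommGroup E'] [NormedSpace ℝ E']
  {N : Type*} [TopologicalSpace N] [ChartedSpace E' N] (f : N → M)

/-- The tangent space at `q` of the submanifold `f : N → M`, as a subspace of `T_{f q} M`. -/
def tangentPlane (q : N) : Submodule ℝ (TangentSpace 𝓘(ℝ, E) (f q)) :=
  LinearMap.range (mfderiv 𝓘(ℝ, E') 𝓘(ℝ, E) f q :
    TangentSpace 𝓘(ℝ, E') q →ₗ[ℝ] TangentSpace 𝓘(ℝ, E) (f q))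

/-- The tangent vector `∇_A (f_* B)` at `f q`, where the vectors `a`, `b` at `q` are extended to the
vector fields `A`, `B` on `N` with constant coefficients in the chart `ψ` of `N`. The computation is
done in the chart `c` of `M`. -/
def covDerivInCharts (c : OpenPartialHomeomorph M E) (ψ : OpenPartialHomeomorph N E') (q : N)
    (a b : TangentSpace 𝓘(ℝ, E') q) : TangentSpace 𝓘(ℝ, E) (f q) :=
  let d : TangentSpace 𝓘(ℝ, E') q →L[ℝ] E' := mfderiv 𝓘(ℝ, E') 𝓘(ℝ, E') ψ q
  let e : E →L[ℝ] E := mfderiv 𝓘(ℝ, E) 𝓘(ℝ, E) c.symm (c (f q))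
  e (CoordMetric.covDerivAlong (S.metricInChart c) (c ∘ f ∘ ψ.symm) (ψ q) (d a) (d b))

/-- `h` is the second fundamental form at `q` of the immersion `f` (Gauss formula): `h(a, b)` is the
normal component of `∇_A (f_* B)`. Since the normal component does not depend on the charts, the
condition is the same for all charts around `q` and `f q`. -/
def IsSecondFundamentalFormAt (q : N)
    (h : TangentSpace 𝓘(ℝ, E') q → TangentSpace 𝓘(ℝ, E') q → TangentSpace 𝓘(ℝ, E) (f q)) : Prop :=
  ∀ a b : TangentSpace 𝓘(ℝ, E') q,
    (∀ t ∈ tangentPlane (E := E) (E' := E') f q, S.g.inner (f q) (h a b) t = 0) ∧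
    ∀ c ∈ atlas E M, f q ∈ c.source → ∀ ψ ∈ atlas E' N, q ∈ ψ.source →
      S.covDerivInCharts f c ψ q a b - h a b ∈ tangentPlane (E := E) (E' := E') f q

/-- `f : N → M` is a totally umbilical immersed submanifold: a smooth map with injective
differentials such that at every point there is a normal vector `η` (the mean curvature vector)
with `h(a, b) = g(a, b) η`. -/
def IsTotallyUmbilical : Prop :=
  ContMDiff 𝓘(ℝ, E') 𝓘(ℝ, E) ∞ f ∧
  (∀ q, Function.Injective (mfderiv 𝓘(ℝ, E') 𝓘(ℝ, E) f q)) ∧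
  ∀ q, ∃ (h : TangentSpace 𝓘(ℝ, E') q → TangentSpace 𝓘(ℝ, E') q → TangentSpace 𝓘(ℝ, E) (f q))
    (η : TangentSpace 𝓘(ℝ, E) (f q)),
    S.IsSecondFundamentalFormAt f q h ∧
    (∀ t ∈ tangentPlane (E := E) (E' := E') f q, S.g.inner (f q) η t = 0) ∧
    ∀ a b, h a b = S.g.inner (f q) (mfderiv 𝓘(ℝ, E') 𝓘(ℝ, E) f q a)
      (mfderiv 𝓘(ℝ, E') 𝓘(ℝ, E) f q b) • η

end Submanifold

/-- The axiom of co-holomorphic `(2n+1)`-spheres: for every point `p` and every co-holomorphic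
`(2n+1)`-plane `σ` at `p` there is a `(2n+1)`-dimensional totally umbilical submanifold through `p`
whose tangent space at `p` is `σ`. -/
def AxiomCoholomorphicSpheres (n : ℕ) : Prop :=
  ∀ (p : M) (σ : Submodule ℝ (TangentSpace 𝓘(ℝ, E) p)), S.IsCoholomorphicPlane n p σ →
    ∃ (N : Type) (_ : TopologicalSpace N)
      (_ : ChartedSpace (EuclideanSpace ℝ (Fin (2 * n + 1))) N)
      (_ : IsManifold 𝓘(ℝ, EuclideanSpace ℝ (Fin (2 * n + 1))) ∞ N)
      (_ : T2Space N) (_ : SecondCountableTopology N) (f : N → M) (q : N),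
      S.IsTotallyUmbilical (E' := EuclideanSpace ℝ (Fin (2 * n + 1))) f ∧
      ∃ hq : f q = p,
        hq ▸ tangentPlane (E := E) (E' := EuclideanSpace ℝ (Fin (2 * n + 1))) f q = σ

end AlmostHermitianStructure

end

/-! The point is that the axiom forces `R(X, Y, JX, JY) = 0` whenever `X`, `Y` are orthogonal and
span an anti-holomorphic plane, so that `λ(X, Y) = K(X, Y)` for such pairs.

For a totally umbilical submanifold the Codazzi equation expresses the normal part of `R(X, Y)Z`
through `g(X, Z)` and `g(Y, Z)` only, so it vanishes for tangent `X`, `Y`, `Z` with `Z` orthogonal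
to `X` and `Y` (`curvatureOp_tangent_of_umbilical` in coordinates, `curvature_eq_zero_of_umbilical`
on `M`). Given an anti-holomorphic pair, choose a holomorphic `2n`-plane `τ` that contains `X` and
is orthogonal to `Y` (`exists_invariant_subspace`). Then `τ ⊕ ℝY` is co-holomorphic, contains `X`,
`Y`, `JX`, and has `JY` as a normal vector; taking `Z = JX` proves the claim (`lam_eq_sectional`).

With `λ = K` on anti-holomorphic pairs, constant curvature gives constant type after rescaling.
Conversely, two anti-holomorphic planes with orthonormal bases `X, Y` and `X', Y'` are linked
through a unit vector `z` orthogonal to `X, JX, X', JX'`, which exists in dimension at least 6: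
`K(X, Y) = K(X, z) = K(X', z) = K(X', Y')`. -/

noncomputable section

/-! ### Levi-Civita calculus and symmetries of the curvature in coordinates. -/

namespace CoordMetric

open Topology

set_option maxSynthPendingDepth 3

section

variable {E : Type*} [NormedAddCommGroup E] [NormedSpace ℝ E]

/-- `G` is a smooth Riemannian metric on the open set `s`. -/
structure IsMetricOn (G : E → E →L[ℝ] E →L[ℝ] ℝ) (s : Set E) : Prop where
  isOpen : IsOpen s
  contDiffOn : ContDiffOn ℝ ∞ G s
  symm : ∀ x ∈ s, ∀ u v, G x u v = G x v u
  pos : ∀ x ∈ s, ∀ u, u ≠ 0 → 0 < G x u u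

theorem christoffelLower_apply (G : E → E →L[ℝ] E →L[ℝ] ℝ) (x u v w : E) :
    christoffelLower G x u v w =
      (1 / 2 : ℝ) * (fderiv ℝ G x u v w + fderiv ℝ G x v u w - fderiv ℝ G x w u v) := by
  simp [christoffelLower]

variable {G : E → E →L[ℝ] E →L[ℝ] ℝ} {s : Set E}

namespace IsMetricOn

variable (hG : IsMetricOn G s)
include hG

theorem contDiffAt {x : E} (hx : x ∈ s) : ContDiffAt ℝ ∞ G x :=
  hG.contDiffOn.contDiffAt (hG.isOpen.mem_nhds hx)

theorem differentiableAt {x : E} (hx : x ∈ s) : DifferentiableAt ℝ G x :=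
  (hG.contDiffAt hx).differentiableAt (by simp)

theorem contDiffAt_fderiv {x : E} (hx : x ∈ s) : ContDiffAt ℝ ∞ (fderiv ℝ G) x :=
  (hG.contDiffAt hx).fderiv_right (by simp)

theorem fderiv_symm {x : E} (hx : x ∈ s) (a u v : E) :
    fderiv ℝ G x a u v = fderiv ℝ G x a v u := by
  have key : ∀ u v, fderiv ℝ (fun y ↦ G y u v) x a = fderiv ℝ G x a u v := fun u v ↦ by
    have h := ((hG.differentiableAt hx).hasFDerivAt.clm_apply
      (hasFDerivAt_const u x)).clm_apply (hasFDerivAt_const v x)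
    rw [h.fderiv]; simp
  rw [← key u v, ← key v u]
  congr 1
  refine Filter.EventuallyEq.fderiv_eq ?_
  filter_upwards [hG.isOpen.mem_nhds hx] with y hy using hG.symm y hy u v

theorem fderiv_eq_add {x : E} (hx : x ∈ s) (a u v : E) :
    fderiv ℝ G x a u v = christoffelLower G x a u v + christoffelLower G x a v u := by
  simp only [christoffelLower_apply]
  rw [hG.fderiv_symm hx v a u, hG.fderiv_symm hx u a v, hG.fderiv_symm hx a v u]
  ring

theorem christoffelLower_comm {x : E} (hx : x ∈ s) (u v : E) :
    christoffelLower G x u v = christoffelLower G x v u := by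
  ext w
  simp only [christoffelLower_apply]
  rw [hG.fderiv_symm hx w u v]
  ring

theorem christoffel_comm {x : E} (hx : x ∈ s) (u v : E) :
    christoffel G x u v = christoffel G x v u := by
  rw [christoffel, christoffel, hG.christoffelLower_comm hx]

variable [FiniteDimensional ℝ E]

/-- Definiteness makes `G x` injective, and `E` and its dual have equal dimension. Without this the
`inverse` in `christoffel` could be the default value `0`. -/
theorem exists_equiv {x : E} (hx : x ∈ s) :
    ∃ e : E ≃L[ℝ] (E →L[ℝ] ℝ), (e : E →L[ℝ] E →L[ℝ] ℝ) = G x := by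
  have hinj : Function.Injective (G x : E →ₗ[ℝ] E →L[ℝ] ℝ) := by
    rw [← LinearMap.ker_eq_bot, LinearMap.ker_eq_bot']
    intro u hu
    by_contra h
    have h1 := hG.pos x hx u h
    have h2 : G x u = 0 := hu
    simp [h2] at h1
  have hdim : Module.finrank ℝ E = Module.finrank ℝ (E →L[ℝ] ℝ) := by
    rw [← (LinearMap.toContinuousLinearMap (𝕜 := ℝ) (E := E) (F' := ℝ)).finrank_eq]
    exact (Subspace.dual_finrank_eq (K := ℝ) (V := E)).symm
  refine ⟨(LinearEquiv.ofInjectiveOfFinrankEq _ hinj hdim).toContinuousLinearEquiv, ?_⟩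
  ext u v
  rfl

theorem apply_christoffel {x : E} (hx : x ∈ s) (u v w : E) :
    G x (christoffel G x u v) w = christoffelLower G x u v w := by
  obtain ⟨e, he⟩ := hG.exists_equiv hx
  rw [christoffel, ← he, ContinuousLinearMap.inverse_equiv]
  simp

end IsMetricOn

variable (G) in
theorem christoffelLower_add_left (x u u' v : E) :
    christoffelLower G x (u + u') v = christoffelLower G x u v + christoffelLower G x u' v := by
  ext w; simp only [christoffelLower_apply, map_add, _root_.add_apply]; ring

variable (G) in
theorem christoffelLower_smul_left (x : E) (r : ℝ) (u v : E) :
    christoffelLower G x (r • u) v = r • christoffelLower G x u v := by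
  ext w
  simp only [christoffelLower_apply, map_smul, _root_.smul_apply, smul_eq_mul]; ring

variable (G) in
theorem christoffelLower_add_right (x u v v' : E) :
    christoffelLower G x u (v + v') = christoffelLower G x u v + christoffelLower G x u v' := by
  ext w; simp only [christoffelLower_apply, map_add, _root_.add_apply]; ring

variable (G) in
theorem christoffelLower_smul_right (x : E) (r : ℝ) (u v : E) :
    christoffelLower G x u (r • v) = r • christoffelLower G x u v := by
  ext w
  simp only [christoffelLower_apply, map_smul, _root_.smul_apply, smul_eq_mul]; ring

variable [FiniteDimensional ℝ E]

variable (G) in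
/-- The Christoffel symbols as a bilinear map. -/
def christoffelL (x : E) : E →L[ℝ] E →L[ℝ] E :=
  LinearMap.toContinuousLinearMap ((LinearMap.toContinuousLinearMap :
      (E →ₗ[ℝ] E) ≃ₗ[ℝ] E →L[ℝ] E).toLinearMap ∘ₗ
    LinearMap.mk₂ ℝ (christoffel G x)
      (fun u u' v ↦ by simp only [christoffel, christoffelLower_add_left, map_add])
      (fun r u v ↦ by simp only [christoffel, christoffelLower_smul_left, map_smul])
      (fun u v v' ↦ by simp only [christoffel, christoffelLower_add_right, map_add])
      (fun r u v ↦ by simp only [christoffel, christoffelLower_smul_right, map_smul]))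

@[simp]
theorem christoffelL_apply (x u v : E) : christoffelL G x u v = christoffel G x u v := rfl

namespace IsMetricOn

variable (hG : IsMetricOn G s)
include hG

theorem contDiffOn_christoffelL : ContDiffOn ℝ ∞ (christoffelL G) s := by
  rw [contDiffOn_clm_apply]
  intro u
  rw [contDiffOn_clm_apply]
  intro v x hx
  refine ContDiffAt.contDiffWithinAt ?_
  have h1 : ContDiffAt ℝ ∞ (fun y ↦ (G y).inverse) x := by
    obtain ⟨e, he⟩ := hG.exists_equiv hx
    have := contDiffAt_map_inverse (𝕜 := ℝ) (n := ∞) e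
    rw [he] at this
    exact this.comp x (hG.contDiffAt hx)
  have hD := hG.contDiffAt_fderiv hx
  have h2 : ContDiffAt ℝ ∞ (fun y ↦ christoffelLower G y u v) x := by
    have h3 : ContDiffAt ℝ ∞ (fun y ↦ ((fderiv ℝ G y).flip u).flip v) x := by
      have : ContDiffOn ℝ ∞ (fun y ↦ ((fderiv ℝ G y).flip u).flip v) s := by
        rw [contDiffOn_clm_apply]
        intro w y hy
        exact ((((hG.contDiffAt_fderiv hy).clm_apply contDiffAt_const).clm_apply
          contDiffAt_const).clm_apply contDiffAt_const).contDiffWithinAt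
      exact this.contDiffAt (hG.isOpen.mem_nhds hx)
    exact ((((hD.clm_apply contDiffAt_const).clm_apply contDiffAt_const).add
      ((hD.clm_apply contDiffAt_const).clm_apply contDiffAt_const)).sub h3).const_smul _
  exact h1.clm_apply h2

theorem hasFDerivAt_christoffelL {x : E} (hx : x ∈ s) :
    HasFDerivAt (christoffelL G) (fderiv ℝ (christoffelL G) x) x :=
  ((hG.contDiffOn_christoffelL.contDiffAt (hG.isOpen.mem_nhds hx)).differentiableAt
    (by simp)).hasFDerivAt

theorem fderiv_christoffel {x : E} (hx : x ∈ s) (u v w : E) :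
    fderiv ℝ (fun y ↦ christoffel G y v w) x u = fderiv ℝ (christoffelL G) x u v w := by
  have h := ((hG.hasFDerivAt_christoffelL hx).clm_apply
      (hasFDerivAt_const v x)).clm_apply (hasFDerivAt_const w x)
  have h' : fderiv ℝ (fun y ↦ christoffel G y v w) x = _ := h.fderiv
  rw [h']; simp

theorem curvatureOp_eq {x : E} (hx : x ∈ s) (u v w : E) :
    curvatureOp G x u v w =
      -(fderiv ℝ (christoffelL G) x u v w - fderiv ℝ (christoffelL G) x v u w
        + christoffelL G x u (christoffelL G x v w)
        - christoffelL G x v (christoffelL G x u w)) := by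
  rw [curvatureOp, hG.fderiv_christoffel hx, hG.fderiv_christoffel hx]; rfl

/-- Metric compatibility `∇G = 0`, obtained from `fderiv_eq_add` by raising the index. -/
theorem fderiv_apply_eq {x : E} (hx : x ∈ s) (a u v : E) :
    fderiv ℝ G x a u v = G x (christoffel G x a u) v + G x u (christoffel G x a v) := by
  rw [hG.fderiv_eq_add hx, hG.symm x hx u, hG.apply_christoffel hx, hG.apply_christoffel hx]

/-- Obtained by differentiating `∇G = 0` once more. The two middle terms are together symmetric in
`a`, `b`; the outer ones carry the curvature. -/
theorem fderiv_fderiv_eq {x : E} (hx : x ∈ s) (a b u v : E) :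
    fderiv ℝ (fderiv ℝ G) x a b u v =
      G x (fderiv ℝ (christoffelL G) x a b u + christoffel G x a (christoffel G x b u)) v
      + G x (christoffel G x b u) (christoffel G x a v)
      + G x (christoffel G x a u) (christoffel G x b v)
      + G x u (fderiv ℝ (christoffelL G) x a b v + christoffel G x a (christoffel G x b v)) := by
  have hΓ := hG.hasFDerivAt_christoffelL hx
  have hg := (hG.differentiableAt hx).hasFDerivAt
  have hD := ((hG.contDiffAt_fderiv hx).differentiableAt (by simp)).hasFDerivAt
  have h1 := ((hD.clm_apply (hasFDerivAt_const b x)).clm_apply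
    (hasFDerivAt_const u x)).clm_apply (hasFDerivAt_const v x)
  have h2 := ((hg.clm_apply ((hΓ.clm_apply (hasFDerivAt_const b x)).clm_apply
    (hasFDerivAt_const u x))).clm_apply (hasFDerivAt_const v x)).add
    ((hg.clm_apply (hasFDerivAt_const u x)).clm_apply
      ((hΓ.clm_apply (hasFDerivAt_const b x)).clm_apply (hasFDerivAt_const v x)))
  have h3 := h2.congr_of_eventuallyEq (f₁ := fun y ↦ fderiv ℝ G y b u v) (by
    filter_upwards [hG.isOpen.mem_nhds hx] with y hy using hG.fderiv_apply_eq hy b u v)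
  have h4 := congrArg (fun l ↦ l a) (h1.unique h3)
  simp only [_root_.add_apply, ContinuousLinearMap.comp_apply,
    ContinuousLinearMap.flip_apply, _root_.zero_apply, map_zero, zero_add,
    christoffelL_apply] at h4
  rw [h4, hG.fderiv_apply_eq hx, hG.fderiv_apply_eq hx]
  simp only [map_add, _root_.add_apply]
  ring

/-- Antisymmetrizing `fderiv_fderiv_eq` in the two directions gives zero on the left, since second
derivatives commute, and the sum of the two curvature terms on the right. -/
theorem apply_curvatureOp_antisymm {x : E} (hx : x ∈ s) (u v w z : E) :
    G x (curvatureOp G x u v w) z = -G x (curvatureOp G x u v z) w := by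
  have hsym : IsSymmSndFDerivAt ℝ G x :=
    (hG.contDiffAt hx).isSymmSndFDerivAt (by simp; exact WithTop.coe_le_coe.2 le_top)
  have h := congrArg (fun l ↦ l w z) (hsym.eq u v)
  simp only [hG.fderiv_fderiv_eq hx] at h
  rw [hG.curvatureOp_eq hx, hG.curvatureOp_eq hx]
  rw [hG.symm x hx w, hG.symm x hx w] at h
  simp only [map_add, map_sub, map_neg, _root_.add_apply,
    _root_.sub_apply, _root_.neg_apply, christoffelL_apply] at h ⊢
  linarith

end IsMetricOn

end

end CoordMetric

/-! ### The Codazzi equation for umbilical immersions in coordinates. -/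

namespace CoordMetric

open Topology

set_option maxSynthPendingDepth 3

section

variable {E : Type*} [NormedAddCommGroup E] [NormedSpace ℝ E] [FiniteDimensional ℝ E]
variable {E' : Type*} [NormedAddCommGroup E'] [NormedSpace ℝ E'] [FiniteDimensional ℝ E']

/-- A covector vanishing on the range of an injective linear map `T y₀` extends to a differentiable
family of covectors vanishing on the ranges of `T y`, for `y` near `y₀`. -/
theorem exists_differentiableAt_annihilator {T : E' → E' →L[ℝ] E} {y₀ : E'}
    (hT : DifferentiableAt ℝ T y₀) (hinj : Function.Injective (T y₀)) {θ₀ : E →L[ℝ] ℝ}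
    (hθ₀ : ∀ t, θ₀ (T y₀ t) = 0) :
    ∃ θ : E' → E →L[ℝ] ℝ, DifferentiableAt ℝ θ y₀ ∧ θ y₀ = θ₀ ∧
      ∀ᶠ y in 𝓝 y₀, ∀ t, θ y (T y t) = 0 := by
  obtain ⟨l, hl⟩ := LinearMap.exists_leftInverse_of_injective (T y₀ : E' →ₗ[ℝ] E)
    (LinearMap.ker_eq_bot.2 hinj)
  set L : E →L[ℝ] E' := LinearMap.toContinuousLinearMap l with hL
  have hA0 : L ∘L T y₀ = (ContinuousLinearEquiv.refl ℝ E' : E' →L[ℝ] E') := by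
    ext t
    exact congrArg (fun f : E' →ₗ[ℝ] E' ↦ f t) hl
  have hA : DifferentiableAt ℝ (fun y ↦ L ∘L T y) y₀ := (differentiableAt_const L).clm_comp hT
  have hinv : DifferentiableAt ℝ (fun y ↦ (L ∘L T y).inverse) y₀ := by
    have h := (contDiffAt_map_inverse (𝕜 := ℝ) (n := 1)
      (ContinuousLinearEquiv.refl ℝ E')).differentiableAt one_ne_zero
    rw [← hA0] at h
    exact h.comp y₀ hA
  -- Here `T (L T)⁻¹ L` is the projection onto the range of `T y` along the kernel of `L`; `θ₀` is
  -- composed with the complementary projection. Near `y₀`, `L T` stays invertible.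
  refine ⟨fun y ↦ θ₀ - ((θ₀ ∘L T y) ∘L (L ∘L T y).inverse) ∘L L, ?_, ?_, ?_⟩
  · exact (differentiableAt_const _).sub
      ((((differentiableAt_const _).clm_comp hT).clm_comp hinv).clm_comp (differentiableAt_const _))
  · have : θ₀ ∘L T y₀ = 0 := by ext t; exact hθ₀ t
    simp [this]
  · have hnhds : ∀ᶠ y in 𝓝 y₀, L ∘L T y ∈
        Set.range ((↑) : (E' ≃L[ℝ] E') → E' →L[ℝ] E') := by
      refine hA.continuousAt.eventually ?_
      change ∀ᶠ f in 𝓝 (L ∘L T y₀), _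
      rw [hA0]
      exact ContinuousLinearEquiv.nhds (ContinuousLinearEquiv.refl ℝ E')
    filter_upwards [hnhds] with y ⟨e, he⟩ t
    have h1 : (L ∘L T y).inverse (L (T y t)) = t := by
      have : L (T y t) = e t := by rw [← ContinuousLinearEquiv.coe_coe, he]; rfl
      rw [this, ← he, ContinuousLinearMap.inverse_equiv]
      simp
    simp [h1]

variable {G : E → E →L[ℝ] E →L[ℝ] ℝ} {s : Set E}

theorem IsMetricOn.apply_curvatureOp_map_smul (hG : IsMetricOn G s) {x : E} (hx : x ∈ s)
    (d : E →L[ℝ] E) (a b : ℝ) (u v w z : E) :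
    G x (curvatureOp G x (d (a • u)) (d (b • v)) (d (a • w))) (d (b • z)) =
      a ^ 2 * b ^ 2 * G x (curvatureOp G x (d u) (d v) (d w)) (d z) := by
  rw [hG.curvatureOp_eq hx, hG.curvatureOp_eq hx]
  simp only [map_smul, _root_.smul_apply, map_neg, map_add, map_sub, _root_.neg_apply,
    _root_.add_apply, _root_.sub_apply, smul_eq_mul]
  ring

/-- A consequence of the Codazzi equation: for a totally umbilical immersion `F`, the vector
`R(X, Y)Z` is tangent whenever `X`, `Y`, `Z` are tangent and `Z` is orthogonal to `X`, `Y`. -/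
theorem IsMetricOn.curvatureOp_tangent_of_umbilical (hG : IsMetricOn G s) {F : E' → E} {y₀ : E'}
    (hF : ContDiffAt ℝ ∞ F y₀) (hy₀ : F y₀ ∈ s) (hinj : Function.Injective (fderiv ℝ F y₀))
    (humb : ∀ᶠ y in 𝓝 y₀, ∃ η : E, ∀ a b, ∃ t, covDerivAlong G F y a b =
      G (F y) (fderiv ℝ F y a) (fderiv ℝ F y b) • η + fderiv ℝ F y t)
    {θ₀ : E →L[ℝ] ℝ} (hθ₀ : ∀ t, θ₀ (fderiv ℝ F y₀ t) = 0) {a b c : E'}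
    (hac : G (F y₀) (fderiv ℝ F y₀ a) (fderiv ℝ F y₀ c) = 0)
    (hbc : G (F y₀) (fderiv ℝ F y₀ b) (fderiv ℝ F y₀ c) = 0) :
    θ₀ (curvatureOp G (F y₀) (fderiv ℝ F y₀ a) (fderiv ℝ F y₀ b) (fderiv ℝ F y₀ c)) = 0 := by
  have hTs : ContDiffAt ℝ ∞ (fderiv ℝ F) y₀ := hF.fderiv_right (by simp)
  have hT2s : ContDiffAt ℝ ∞ (fderiv ℝ (fderiv ℝ F)) y₀ := hTs.fderiv_right (by simp)
  have htwo : minSmoothness ℝ 2 ≤ (∞ : WithTop ℕ∞) := by simp; exact WithTop.coe_le_coe.2 le_top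
  have hsym : IsSymmSndFDerivAt ℝ F y₀ := hF.isSymmSndFDerivAt htwo
  have hsym' : IsSymmSndFDerivAt ℝ (fderiv ℝ F) y₀ := hTs.isSymmSndFDerivAt htwo
  -- A moving conormal `θ` replaces the normal connection: everything below is obtained by
  -- differentiating scalar functions.
  obtain ⟨θ, hθ, rfl, hθT⟩ :=
    exists_differentiableAt_annihilator (hTs.differentiableAt (by simp)) hinj hθ₀
  have dF := (hF.differentiableAt (by simp)).hasFDerivAt
  have dT := (hTs.differentiableAt (by simp)).hasFDerivAt
  have dT2 := (hT2s.differentiableAt (by simp)).hasFDerivAt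
  have dθ := hθ.hasFDerivAt
  have dG := (hG.differentiableAt hy₀).hasFDerivAt.comp y₀ dF
  have dΓ := (hG.hasFDerivAt_christoffelL hy₀).comp y₀ dF
  set T := fderiv ℝ F with hTdef
  set D2 := fderiv ℝ T y₀ with hD2
  set D3 := fderiv ℝ (fderiv ℝ T) y₀ with hD3
  set Γ := christoffelL G (F y₀) with hΓ
  set dΓ0 := fderiv ℝ (christoffelL G) (F y₀) with hdΓ0
  set θ' := fderiv ℝ θ y₀ with hθ'
  have B_eq : ∀ u v, covDerivAlong G F y₀ u v = D2 u v + Γ (T y₀ u) (T y₀ v) := fun u v ↦ rfl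
  have B_symm : ∀ u v, covDerivAlong G F y₀ u v = covDerivAlong G F y₀ v u := fun u v ↦ by
    rw [B_eq, B_eq, hsym.eq u v, hΓ, christoffelL_apply, christoffelL_apply,
      hG.christoffel_comm hy₀]
  -- the derivative of the second fundamental form
  have dK : ∀ u v, ∃ K' : E' →L[ℝ] ℝ,
      HasFDerivAt (fun y ↦ θ y (covDerivAlong G F y u v)) K' y₀ ∧
      ∀ x, K' x = θ' x (covDerivAlong G F y₀ u v) + θ y₀ (D3 x u v +
        dΓ0 (T y₀ x) (T y₀ u) (T y₀ v) + Γ (D2 x u) (T y₀ v) + Γ (T y₀ u) (D2 x v)) := by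
    intro u v
    refine ⟨_, dθ.clm_apply (((dT2.clm_apply (hasFDerivAt_const u y₀)).clm_apply
      (hasFDerivAt_const v y₀)).add ((dΓ.clm_apply (dT.clm_apply
      (hasFDerivAt_const u y₀))).clm_apply (dT.clm_apply (hasFDerivAt_const v y₀)))), fun x ↦ ?_⟩
    simp only [_root_.add_apply, ContinuousLinearMap.comp_apply,
      ContinuousLinearMap.flip_apply, _root_.zero_apply, map_zero, zero_add,
      Function.comp_apply, map_add, B_eq]
    ring
  have dN : ∀ u v, ∃ N' : E' →L[ℝ] ℝ,
      HasFDerivAt (fun y ↦ G (F y) (T y u) (T y v)) N' y₀ ∧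
      ∀ x, N' x = G (F y₀) (covDerivAlong G F y₀ x u) (T y₀ v) +
        G (F y₀) (T y₀ u) (covDerivAlong G F y₀ x v) := by
    intro u v
    refine ⟨_, (dG.clm_apply (dT.clm_apply (hasFDerivAt_const u y₀))).clm_apply
      (dT.clm_apply (hasFDerivAt_const v y₀)), fun x ↦ ?_⟩
    simp only [_root_.add_apply, ContinuousLinearMap.comp_apply,
      ContinuousLinearMap.flip_apply, _root_.zero_apply, map_zero, zero_add,
      Function.comp_apply, map_add, B_eq]
    rw [hG.fderiv_apply_eq hy₀]
    simp only [hΓ, christoffelL_apply]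
    ring
  have dθT : ∀ x t, θ' x (T y₀ t) + θ y₀ (D2 x t) = 0 := by
    intro x t
    have h1 := dθ.clm_apply (dT.clm_apply (hasFDerivAt_const t y₀))
    have h2 := h1.congr_of_eventuallyEq (f₁ := fun _ ↦ (0 : ℝ)) (by
      filter_upwards [hθT] with y hy using (hy t).symm)
    have h3 := congrArg (fun l ↦ l x) (h2.unique (hasFDerivAt_const (0 : ℝ) y₀))
    simp only [_root_.add_apply, ContinuousLinearMap.comp_apply,
      ContinuousLinearMap.flip_apply, _root_.zero_apply, map_zero, zero_add] at h3
    linarith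
  -- `σ` is the conormal component of the mean curvature vector; `η` is chosen pointwise, so no
  -- regularity is known yet.
  obtain ⟨σ, hσ⟩ : ∃ σ : E' → ℝ, ∀ᶠ y in 𝓝 y₀, ∀ u v,
      θ y (covDerivAlong G F y u v) = G (F y) (T y u) (T y v) * σ y := by
    choose! η hη using humb.exists_mem.choose_spec.2
    refine ⟨fun y ↦ θ y (η y), ?_⟩
    filter_upwards [hθT, humb.exists_mem.choose_spec.1] with y h1 h2 u v
    obtain ⟨t, ht⟩ := hη y h2 u v
    rw [ht, map_add, h1, map_smul, smul_eq_mul, add_zero]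
  rcases eq_or_ne c 0 with rfl | hc
  · have : curvatureOp G (F y₀) (T y₀ a) (T y₀ b) (T y₀ 0) = 0 := by
      rw [hG.curvatureOp_eq hy₀]; simp [-christoffelL_apply]
    rw [this, map_zero]
  have hTc : T y₀ c ≠ 0 := fun h ↦ hc (hinj (by rw [h, map_zero]))
  have hNc : G (F y₀) (T y₀ c) (T y₀ c) ≠ 0 := (hG.pos _ hy₀ _ hTc).ne'
  -- Near `y₀`, `σ` is the quotient of `θ (B(c, c))` by the squared length of `T c`, with `B` the
  -- covariant derivative along `F`. This is why `c = 0` was treated separately.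
  have dσ : DifferentiableAt ℝ σ y₀ := by
    obtain ⟨K', hK', -⟩ := dK c c
    obtain ⟨N', hN', -⟩ := dN c c
    refine (hK'.differentiableAt.mul (hN'.differentiableAt.fun_inv hNc)).congr_of_eventuallyEq ?_
    filter_upwards [hσ, hN'.continuousAt.eventually_ne hNc] with y h1 h2
    rw [Pi.mul_apply, h1, mul_comm, inv_mul_cancel_left₀ h2]
  -- Differentiate `θ (B(u, c)) = G(T u, T c) σ` in the direction `x`. The derivative of `σ` is
  -- multiplied by `G(T u, T c) = 0` and drops out.
  have key : ∀ x u, G (F y₀) (T y₀ u) (T y₀ c) = 0 →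
      θ' x (covDerivAlong G F y₀ u c) + θ y₀ (D3 x u c +
        dΓ0 (T y₀ x) (T y₀ u) (T y₀ c) + Γ (D2 x u) (T y₀ c) + Γ (T y₀ u) (D2 x c)) =
      (G (F y₀) (covDerivAlong G F y₀ x u) (T y₀ c) +
        G (F y₀) (T y₀ u) (covDerivAlong G F y₀ x c)) * σ y₀ := by
    intro x u hu
    obtain ⟨K', hK', hK⟩ := dK u c
    obtain ⟨N', hN', hN⟩ := dN u c
    have h1 := (hN'.mul dσ.hasFDerivAt).congr_of_eventuallyEq
      (f₁ := fun y ↦ θ y (covDerivAlong G F y u c)) (by filter_upwards [hσ] with y hy using hy u c)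
    have h2 := congrArg (fun l ↦ l x) (hK'.unique h1)
    simp only [_root_.smul_apply, hu, zero_smul, zero_add, smul_eq_mul] at h2
    rw [← hK, h2, ← hN, mul_comm]
  -- By umbilicity `B(u, c)` is a tangent vector `T t`, and `θ'` on tangent vectors is known from
  -- differentiating `θ (T t) = 0`. Umbilicity then evaluates `θ (B(x, t))`.
  have tang : ∀ x u, G (F y₀) (T y₀ u) (T y₀ c) = 0 →
      θ' x (covDerivAlong G F y₀ u c) - θ y₀ (Γ (T y₀ x) (covDerivAlong G F y₀ u c)) =
      - (G (F y₀) (T y₀ x) (covDerivAlong G F y₀ u c) * σ y₀) := by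
    intro x u hu
    obtain ⟨η, hη⟩ := humb.self_of_nhds
    obtain ⟨t, ht⟩ := hη u c
    rw [hu, zero_smul, zero_add] at ht
    rw [ht]
    have h1 := dθT x t
    have h2 := hσ.self_of_nhds x t
    rw [B_eq, map_add] at h2
    linarith
  -- After substituting `tang` into `key`, the coefficient of `σ` is `G(B(a, b), T c) + G(T b, B(a,
  -- c)) + G(T a, B(b, c))`, which is symmetric in `a`, `b`. The terms in `D2` and `D3` are
  -- symmetric as well, so the difference of the two instances leaves only `θ` of the curvature.
  have k1 := key a b hbc
  have k2 := key b a hac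
  have t1 := tang a b hbc
  have t2 := tang b a hac
  have s1 : D3 a b c = D3 b a c := congrArg (fun l ↦ l c) (hsym'.eq a b)
  have s2 : D2 a b = D2 b a := hsym.eq a b
  rw [B_symm b a, s2.symm, s1.symm] at k2
  have e1 := B_eq a c
  have e2 := B_eq b c
  rw [hG.curvatureOp_eq hy₀]
  rw [e1, e2] at k1 k2
  rw [e2] at t1
  rw [e1] at t2
  simp only [map_add, map_sub, map_neg] at k1 k2 t1 t2 ⊢
  linarith

end

end CoordMetric

/-! ### Transfer between the manifold and its charts. -/

namespace AlmostHermitianStructure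

open Topology

set_option maxSynthPendingDepth 3

section

variable {E : Type*} [NormedAddCommGroup E] [NormedSpace ℝ E]
  {M : Type*} [TopologicalSpace M] [ChartedSpace E M] [IsManifold 𝓘(ℝ, E) ∞ M]
  (S : AlmostHermitianStructure E M)

theorem mfderiv_chartAt_symm_mfderiv_chartAt {p p' : M} (hp' : p' ∈ (chartAt E p).source)
    (v : TangentSpace 𝓘(ℝ, E) p') :
    mfderiv 𝓘(ℝ, E) 𝓘(ℝ, E) (chartAt E p).symm (chartAt E p p')
      (mfderiv 𝓘(ℝ, E) 𝓘(ℝ, E) (chartAt E p) p' v) = v :=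
  congrArg (fun l : E →L[ℝ] E ↦ l v)
    ((mdifferentiable_chart (I := 𝓘(ℝ, E)) p).symm_comp_deriv hp')

theorem mfderiv_chartAt_mfderiv_chartAt_symm {p p' : M} (hp' : p' ∈ (chartAt E p).source)
    (v : E) :
    (mfderiv 𝓘(ℝ, E) 𝓘(ℝ, E) (chartAt E p) p' : E →L[ℝ] E)
      (mfderiv 𝓘(ℝ, E) 𝓘(ℝ, E) (chartAt E p).symm (chartAt E p p') v : E) = v := by
  obtain ⟨w, rfl⟩ := ((mdifferentiable_chart (I := 𝓘(ℝ, E)) p).mfderiv_surjective hp') v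
  exact congrArg (mfderiv 𝓘(ℝ, E) 𝓘(ℝ, E) (chartAt E p) p')
    (mfderiv_chartAt_symm_mfderiv_chartAt hp' w)

theorem metricInChart_mfderiv {p p' : M} (hp' : p' ∈ (chartAt E p).source)
    (v w : TangentSpace 𝓘(ℝ, E) p') :
    S.metricInChart (chartAt E p) (chartAt E p p')
      (mfderiv 𝓘(ℝ, E) 𝓘(ℝ, E) (chartAt E p) p' v)
      (mfderiv 𝓘(ℝ, E) 𝓘(ℝ, E) (chartAt E p) p' w) = S.g.inner p' v w := by
  refine (S.metricInChart_apply _ _ _ _).trans ?_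
  have hv := mfderiv_chartAt_symm_mfderiv_chartAt hp' v
  have hw := mfderiv_chartAt_symm_mfderiv_chartAt hp' w
  -- The base point `c.symm (c p')` equals `p'` only propositionally, and the tangent spaces depend
  -- on it; a free base point `r` allows substitution.
  have key : ∀ r : M, r = p' → ∀ v' w' : E, v' = v → w' = w →
      S.g.inner r v' w' = S.g.inner p' v w := by
    rintro r rfl v' w' rfl rfl; rfl
  exact key _ ((chartAt E p).left_inv hp') _ _ hv hw

/-- This is the tangent map of the inverse chart applied to the constant field `u`. The coefficients
of the metric thereby become pairings of smooth sections. -/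
theorem contMDiffOn_mfderiv_chartAt_symm (p : M) (u : E) :
    ContMDiffOn 𝓘(ℝ, E) (𝓘(ℝ, E).prod 𝓘(ℝ, E)) ∞
      (fun x : E ↦ Bundle.TotalSpace.mk' E (E := fun x : M ↦ TangentSpace 𝓘(ℝ, E) x)
        ((chartAt E p).symm x) (mfderiv 𝓘(ℝ, E) 𝓘(ℝ, E) (chartAt E p).symm x u))
      (chartAt E p).target := by
  have h1 : ContMDiffOn 𝓘(ℝ, E) 𝓘(ℝ, E) ∞ (chartAt E p).symm (chartAt E p).target :=
    contMDiffOn_chart_symm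
  have h2 := h1.contMDiffOn_tangentMapWithin (m := ∞) (by simp)
    (chartAt E p).open_target.uniqueMDiffOn
  have h3 : ContMDiff 𝓘(ℝ, E) (𝓘(ℝ, E).prod 𝓘(ℝ, E)) ∞
      (fun x : E ↦ (⟨x, u⟩ : TangentBundle 𝓘(ℝ, E) E)) :=
    contMDiff_vectorSpace_iff_contDiff.2 contDiff_const
  refine (h2.comp h3.contMDiffOn (s := (chartAt E p).target) (fun x hx ↦ hx)).congr ?_
  intro x hx
  simp only [Function.comp_apply, tangentMapWithin]
  rw [mfderivWithin_of_isOpen (chartAt E p).open_target hx]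

variable [FiniteDimensional ℝ E]

theorem isMetricOn_metricInChart (p : M) :
    CoordMetric.IsMetricOn (S.metricInChart (chartAt E p)) (chartAt E p).target where
  isOpen := (chartAt E p).open_target
  contDiffOn := by
    rw [contDiffOn_clm_apply]
    intro u
    rw [contDiffOn_clm_apply]
    intro v
    have hg : ContMDiffOn 𝓘(ℝ, E) (𝓘(ℝ, E).prod 𝓘(ℝ, E →L[ℝ] E →L[ℝ] ℝ)) ∞
        (fun x : E ↦ Bundle.TotalSpace.mk' (E →L[ℝ] E →L[ℝ] ℝ)
          (E := fun x : M ↦ TangentSpace 𝓘(ℝ, E) x →L[ℝ] TangentSpace 𝓘(ℝ, E) x →L[ℝ]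
            Bundle.Trivial M ℝ x)
          ((chartAt E p).symm x) (S.g.inner ((chartAt E p).symm x))) (chartAt E p).target :=
      S.g.contMDiff.comp_contMDiffOn (contMDiffOn_chart_symm (x := p))
    have h := ContMDiffOn.clm_bundle_apply₂ (F₁ := E) (F₂ := E) (F₃ := ℝ)
      (E₃ := Bundle.Trivial M ℝ) hg
      (contMDiffOn_mfderiv_chartAt_symm p u) (contMDiffOn_mfderiv_chartAt_symm p v)
    rw [← contMDiffOn_iff_contDiffOn]
    intro x hx
    have h' := h x hx
    rw [Bundle.contMDiffWithinAt_totalSpace] at h'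
    exact h'.2
  symm x hx u v := by rw [metricInChart_apply, metricInChart_apply, S.g.symm]
  pos x hx u hu := by
    rw [metricInChart_apply]
    apply S.g.pos
    intro h
    have hinj := (mdifferentiable_chart (I := 𝓘(ℝ, E)) p).symm.mfderiv_injective hx
    exact hu (hinj (h.trans (map_zero (mfderiv 𝓘(ℝ, E) 𝓘(ℝ, E) (chartAt E p).symm x)).symm))

omit [FiniteDimensional ℝ E] in
theorem curvature_antisymm_left (p : M) (X Y Z U : TangentSpace 𝓘(ℝ, E) p) :
    S.curvature p Y X Z U = -S.curvature p X Y Z U := by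
  simp only [curvature]
  rw [← _root_.neg_apply, ← map_neg]
  congr 2
  simp only [CoordMetric.curvatureOp]
  abel

theorem curvature_antisymm_right (p : M) (X Y Z U : TangentSpace 𝓘(ℝ, E) p) :
    S.curvature p X Y U Z = -S.curvature p X Y Z U :=
  (S.isMetricOn_metricInChart p).apply_curvatureOp_antisymm (mem_chart_target E p) _ _ _ _

theorem curvature_smul (p : M) (a b : ℝ) (X Y Z U : TangentSpace 𝓘(ℝ, E) p) :
    S.curvature p (a • X) (b • Y) (a • Z) (b • U) = a ^ 2 * b ^ 2 * S.curvature p X Y Z U :=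
  (S.isMetricOn_metricInChart p).apply_curvatureOp_map_smul (mem_chart_target E p) _ _ _ _ _ _ _

variable {E' : Type*} [NormedAddCommGroup E'] [NormedSpace ℝ E'] [FiniteDimensional ℝ E']
  {N : Type*} [TopologicalSpace N] [ChartedSpace E' N] [IsManifold 𝓘(ℝ, E') ∞ N] {f : N → M}

omit [FiniteDimensional ℝ E] [FiniteDimensional ℝ E'] in
theorem contDiffAt_inCharts (hf : ContMDiff 𝓘(ℝ, E') 𝓘(ℝ, E) ∞ f) {p : M} {q q' : N}
    (hq' : q' ∈ (chartAt E' q).source) (hp : f q' ∈ (chartAt E p).source) :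
    ContDiffAt ℝ ∞ (chartAt E p ∘ f ∘ (chartAt E' q).symm) (chartAt E' q q') := by
  have hl := (chartAt E' q).left_inv hq'
  rw [← contMDiffAt_iff_contDiffAt]
  have h1 : ContMDiffAt 𝓘(ℝ, E') 𝓘(ℝ, E') ∞ (chartAt E' q).symm (chartAt E' q q') :=
    (contMDiffOn_chart_symm (x := q)).contMDiffAt
      ((chartAt E' q).open_target.mem_nhds ((chartAt E' q).map_source hq'))
  have h2 : ContMDiffAt 𝓘(ℝ, E) 𝓘(ℝ, E) ∞ (chartAt E p)
      ((f ∘ (chartAt E' q).symm) (chartAt E' q q')) := by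
    rw [Function.comp_apply, hl]
    exact (contMDiffOn_chart (x := p)).contMDiffAt ((chartAt E p).open_source.mem_nhds hp)
  exact h2.comp _ (hf.contMDiffAt.comp _ h1)

-- Chain rule: both sides differentiate the function `c ∘ f` at `q'`, which agrees near `q'` with
-- `(c ∘ f ∘ ψ.symm) ∘ ψ`.
omit [FiniteDimensional ℝ E] [FiniteDimensional ℝ E'] in
theorem fderiv_inCharts (hf : ContMDiff 𝓘(ℝ, E') 𝓘(ℝ, E) ∞ f) {p : M} {q q' : N}
    (hq' : q' ∈ (chartAt E' q).source) (hp : f q' ∈ (chartAt E p).source)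
    (t : TangentSpace 𝓘(ℝ, E') q') :
    fderiv ℝ (chartAt E p ∘ f ∘ (chartAt E' q).symm) (chartAt E' q q')
      (mfderiv 𝓘(ℝ, E') 𝓘(ℝ, E') (chartAt E' q) q' t) =
    mfderiv 𝓘(ℝ, E) 𝓘(ℝ, E) (chartAt E p) (f q') (mfderiv 𝓘(ℝ, E') 𝓘(ℝ, E) f q' t) := by
  have hF := ((contDiffAt_inCharts hf hq' hp).differentiableAt
    (by simp)).mdifferentiableAt.hasMFDerivAt
  have hψ := ((mdifferentiable_chart (I := 𝓘(ℝ, E')) q).mdifferentiableAt hq').hasMFDerivAt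
  have hc := ((mdifferentiable_chart (I := 𝓘(ℝ, E)) p).mdifferentiableAt hp).hasMFDerivAt
  have hff := (hf.mdifferentiable (by simp) q').hasMFDerivAt
  have h1 := hF.comp q' hψ
  have h2 := hc.comp q' hff
  have h3 := h2.congr_of_eventuallyEq
    (f₁ := (chartAt E p ∘ f ∘ (chartAt E' q).symm) ∘ chartAt E' q) (by
      filter_upwards [(chartAt E' q).open_source.mem_nhds hq'] with r hr
      simp [(chartAt E' q).left_inv hr])
  have h4 := congrArg (fun l : E' →L[ℝ] E ↦ l t) (hasMFDerivAt_unique h1 h3)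
  rw [mfderiv_eq_fderiv] at h4
  exact h4

-- The charts at `p` and `q` stay fixed while `q'` moves: the Codazzi argument differentiates the
-- umbilicity condition, so it is needed on a whole neighbourhood in one pair of charts.
omit [FiniteDimensional ℝ E] [FiniteDimensional ℝ E'] in
theorem exists_covDerivAlong_eq (hf : S.IsTotallyUmbilical f (E' := E')) {p : M} {q q' : N}
    (hq' : q' ∈ (chartAt E' q).source) (hp : f q' ∈ (chartAt E p).source) :
    ∃ η : E, ∀ a b, ∃ t, CoordMetric.covDerivAlong (S.metricInChart (chartAt E p))
      (chartAt E p ∘ f ∘ (chartAt E' q).symm) (chartAt E' q q') a b =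
      S.metricInChart (chartAt E p) (chartAt E p (f q'))
        (fderiv ℝ (chartAt E p ∘ f ∘ (chartAt E' q).symm) (chartAt E' q q') a)
        (fderiv ℝ (chartAt E p ∘ f ∘ (chartAt E' q).symm) (chartAt E' q q') b) • η +
      fderiv ℝ (chartAt E p ∘ f ∘ (chartAt E' q).symm) (chartAt E' q q') t := by
  obtain ⟨h, η, hh, -, humb⟩ := hf.2.2 q'
  refine ⟨mfderiv 𝓘(ℝ, E) 𝓘(ℝ, E) (chartAt E p) (f q') η, fun a b ↦ ?_⟩
  have hψ := (mdifferentiable_chart (I := 𝓘(ℝ, E')) q).mfderiv_surjective hq'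
  obtain ⟨a, rfl⟩ := hψ a
  obtain ⟨b, rfl⟩ := hψ b
  obtain ⟨t, ht⟩ := (hh a b).2 (chartAt E p) (chart_mem_atlas E p) hp (chartAt E' q)
    (chart_mem_atlas E' q) hq'
  refine ⟨mfderiv 𝓘(ℝ, E') 𝓘(ℝ, E') (chartAt E' q) q' t, ?_⟩
  have h1 := fderiv_inCharts hf.1 hq' hp
  rw [h1 a, h1 b, h1 t, S.metricInChart_mfderiv hp]
  have ht' := congrArg (fun v : E ↦ (mfderiv 𝓘(ℝ, E) 𝓘(ℝ, E) (chartAt E p) (f q') : E →L[ℝ] E) v)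
    (sub_eq_iff_eq_add.1 ht.symm)
  simp only [covDerivInCharts, humb] at ht'
  have h2 := (mfderiv_chartAt_mfderiv_chartAt_symm hp _).symm.trans ht'
  refine h2.trans ?_
  refine (map_add (mfderiv 𝓘(ℝ, E) 𝓘(ℝ, E) (chartAt E p) (f q')) _ _).trans ?_
  refine (add_comm _ _).trans (congrArg₂ (· + ·) ?_ rfl)
  exact map_smul (mfderiv 𝓘(ℝ, E) 𝓘(ℝ, E) (chartAt E p) (f q')) _ _

set_option maxHeartbeats 1600000 in
/-- At a point of a totally umbilical submanifold, `R(X, Y, Z, ξ) = 0` for a normal vector `ξ` and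
tangent vectors `X`, `Y`, `Z` such that `Z` is orthogonal to `X` and `Y`. -/
theorem curvature_eq_zero_of_umbilical (hf : S.IsTotallyUmbilical f (E' := E')) (q : N)
    {X Y Z ξ : TangentSpace 𝓘(ℝ, E) (f q)} (hX : X ∈ tangentPlane (E := E) (E' := E') f q)
    (hY : Y ∈ tangentPlane (E := E) (E' := E') f q)
    (hZ : Z ∈ tangentPlane (E := E) (E' := E') f q)
    (hξ : ∀ t ∈ tangentPlane (E := E) (E' := E') f q, S.g.inner (f q) t ξ = 0)
    (hXZ : S.g.inner (f q) X Z = 0) (hYZ : S.g.inner (f q) Y Z = 0) :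
    S.curvature (f q) X Y Z ξ = 0 := by
  obtain ⟨a, rfl⟩ := hX
  obtain ⟨b, rfl⟩ := hY
  obtain ⟨c, rfl⟩ := hZ
  have hq := mem_chart_source E' q
  have hp := mem_chart_source E (f q)
  have hψ := (mdifferentiable_chart (I := 𝓘(ℝ, E')) q).mfderiv_bijective hq
  have hF : (chartAt E (f q) ∘ f ∘ (chartAt E' q).symm) (chartAt E' q q) = chartAt E (f q) (f q) :=
    congrArg (fun r ↦ chartAt E (f q) (f r)) ((chartAt E' q).left_inv hq)
  have h1 := fderiv_inCharts hf.1 hq hp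
  have hg := S.metricInChart_mfderiv hp
  have key := (S.isMetricOn_metricInChart (f q)).curvatureOp_tangent_of_umbilical
    (F := chartAt E (f q) ∘ f ∘ (chartAt E' q).symm) (y₀ := chartAt E' q q)
    (contDiffAt_inCharts hf.1 hq hp) (by rw [hF]; exact mem_chart_target E (f q))
    (by
      rw [injective_iff_map_eq_zero]
      intro t ht
      obtain ⟨t, rfl⟩ := hψ.2 t
      rw [h1] at ht
      have h2 := (mdifferentiable_chart (I := 𝓘(ℝ, E)) (f q)).mfderiv_injective hp
        (ht.trans (map_zero (mfderiv 𝓘(ℝ, E) 𝓘(ℝ, E) (chartAt E (f q)) (f q))).symm)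
      have h3 := hf.2.1 q (h2.trans (map_zero (mfderiv 𝓘(ℝ, E') 𝓘(ℝ, E) f q)).symm)
      rw [h3]
      exact map_zero (mfderiv 𝓘(ℝ, E') 𝓘(ℝ, E') (chartAt E' q) q))
    (by
      have hs : f ⁻¹' (chartAt E (f q)).source ∈ 𝓝 ((chartAt E' q).symm (chartAt E' q q)) := by
        rw [(chartAt E' q).left_inv hq]
        exact hf.1.continuous.continuousAt ((chartAt E (f q)).open_source.mem_nhds hp)
      filter_upwards [(chartAt E' q).open_target.mem_nhds (mem_chart_target E' q),
        ((chartAt E' q).continuousAt_symm (mem_chart_target E' q)) hs] with y hy hy'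
      have h2 := S.exists_covDerivAlong_eq hf ((chartAt E' q).map_target hy) hy'
      rw [(chartAt E' q).right_inv hy] at h2
      exact h2)
    -- The conormal is `g(·, ξ)`, so its value on `R(X, Y)Z` is `R(X, Y, Z, ξ)`.
    (θ₀ := (S.metricInChart (chartAt E (f q)) (chartAt E (f q) (f q))).flip
      (mfderiv 𝓘(ℝ, E) 𝓘(ℝ, E) (chartAt E (f q)) (f q) ξ))
    (by
      intro t
      obtain ⟨t, rfl⟩ := hψ.2 t
      rw [h1]
      exact (hg _ _).trans (hξ _ ⟨t, rfl⟩))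
    (a := mfderiv 𝓘(ℝ, E') 𝓘(ℝ, E') (chartAt E' q) q a)
    (b := mfderiv 𝓘(ℝ, E') 𝓘(ℝ, E') (chartAt E' q) q b)
    (c := mfderiv 𝓘(ℝ, E') 𝓘(ℝ, E') (chartAt E' q) q c)
    (by rw [hF, h1, h1, hg]; exact hXZ) (by rw [hF, h1, h1, hg]; exact hYZ)
  rw [hF, h1, h1, h1] at key
  exact key

end

end AlmostHermitianStructure

/-! ### Linear algebra of Hermitian vector spaces. -/

/-- A Hermitian structure on a real vector space: a positive definite symmetric form `g` and a
complex structure `J` that preserves it. -/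
structure IsHermitianPair {V : Type*} [AddCommGroup V] [Module ℝ V]
    (g : V →ₗ[ℝ] V →ₗ[ℝ] ℝ) (J : V →ₗ[ℝ] V) : Prop where
  symm : ∀ u v, g u v = g v u
  pos : ∀ u, u ≠ 0 → 0 < g u u
  J_J : ∀ u, J (J u) = -u
  inner_J_J : ∀ u v, g (J u) (J v) = g u v

namespace IsHermitianPair

open Module Submodule

variable {V : Type*} [AddCommGroup V] [Module ℝ V] {g : V →ₗ[ℝ] V →ₗ[ℝ] ℝ} {J : V →ₗ[ℝ] V}
  (h : IsHermitianPair g J)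
include h

theorem inner_J_left (u v : V) : g (J u) v = -g u (J v) := by
  rw [← h.inner_J_J (J u) v, h.J_J, map_neg, LinearMap.neg_apply]

theorem inner_J_self (u : V) : g (J u) u = 0 := by
  have h1 := h.inner_J_left u u
  rw [h.symm u] at h1
  linarith

theorem inner_self_J (u : V) : g u (J u) = 0 := by rw [h.symm, h.inner_J_self]

theorem eq_zero_of_inner_self {u : V} (hu : g u u = 0) : u = 0 := by
  by_contra h1
  exact (h.pos u h1).ne' hu

theorem J_ne_zero {u : V} (hu : u ≠ 0) : J u ≠ 0 := fun h0 ↦ by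
  have := h.J_J u
  rw [h0, map_zero] at this
  exact hu (neg_eq_zero.1 this.symm)

theorem finrank_span_pair {u v : V} (hu : u ≠ 0) (hv : v ≠ 0) (huv : g u v = 0) :
    finrank ℝ (span ℝ {u, v}) = 2 := by
  have hli : LinearIndependent ℝ ![u, v] := by
    rw [LinearIndependent.pair_iff]
    intro s t hst
    have h1 := congrArg (g u) hst
    have h2 := congrArg (g v) hst
    rw [map_add, map_smul, map_smul, huv, map_zero] at h1
    rw [map_add, map_smul, map_smul, h.symm v u, huv, map_zero] at h2
    simp only [smul_eq_mul, mul_zero, add_zero, zero_add, mul_eq_zero] at h1 h2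
    exact ⟨h1.resolve_right (h.pos u hu).ne', h2.resolve_right (h.pos v hv).ne'⟩
  have := finrank_span_eq_card hli
  rwa [Matrix.range_cons_cons_empty, Fintype.card_fin] at this

variable [FiniteDimensional ℝ V]

-- The map `z ↦ g z` restricted to `W` takes values in the dual of `W`, of smaller dimension than
-- `V`, so it has a nonzero kernel.
omit h in
theorem exists_orthogonal (g : V →ₗ[ℝ] V →ₗ[ℝ] ℝ) (W : Submodule ℝ V)
    (hW : finrank ℝ W < finrank ℝ V) : ∃ z, z ≠ 0 ∧ ∀ w ∈ W, g z w = 0 := by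
  have hd : finrank ℝ (Module.Dual ℝ W) < finrank ℝ V := by
    rwa [Subspace.dual_finrank_eq]
  have hk := LinearMap.ker_ne_bot_of_finrank_lt (f := W.dualRestrict ∘ₗ g) hd
  obtain ⟨z, hz, hz0⟩ := (Submodule.ne_bot_iff _).1 hk
  exact ⟨z, hz0, fun w hw ↦ congrArg (fun l : Module.Dual ℝ W ↦ l ⟨w, hw⟩) hz⟩

theorem finrank_sup_of_orthogonal {A B : Submodule ℝ V} (hAB : ∀ a ∈ A, ∀ b ∈ B, g a b = 0) :
    finrank ℝ (A ⊔ B : Submodule ℝ V) = finrank ℝ A + finrank ℝ B := by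
  have hd : A ⊓ B = ⊥ := by
    rw [eq_bot_iff]
    intro v hv
    exact h.eq_zero_of_inner_self (hAB v hv.1 v hv.2)
  have := Submodule.finrank_sup_add_finrank_inf_eq A B
  rwa [hd, finrank_bot, add_zero] at this

/-- Since `τ` is `J`-invariant and `J` is skew, `J z` is orthogonal to `τ` along with `z`. This is
the induction step that builds holomorphic planes two dimensions at a time. -/
theorem exists_sup_span {τ : Submodule ℝ V} (hτ : ∀ t ∈ τ, J t ∈ τ) {z : V} (hz : z ≠ 0)
    (hzτ : ∀ t ∈ τ, g z t = 0) :
    finrank ℝ (τ ⊔ span ℝ {z, J z} : Submodule ℝ V) = finrank ℝ τ + 2 ∧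
      ∀ t ∈ τ ⊔ span ℝ {z, J z}, J t ∈ τ ⊔ span ℝ {z, J z} := by
  constructor
  · rw [h.finrank_sup_of_orthogonal, h.finrank_span_pair hz (h.J_ne_zero hz) (h.inner_self_J z)]
    intro t ht v hv
    obtain ⟨a, b, rfl⟩ := mem_span_pair.1 hv
    have h2 := h.inner_J_left t z
    rw [h.symm (J t), hzτ _ (hτ t ht)] at h2
    rw [map_add, map_smul, map_smul, h.symm t z, hzτ t ht, neg_eq_zero.1 h2.symm]
    simp
  · intro v hv
    obtain ⟨t, ht, w, hw, rfl⟩ := mem_sup.1 hv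
    obtain ⟨a, b, rfl⟩ := mem_span_pair.1 hw
    refine mem_sup.2 ⟨J t, hτ t ht, _, mem_span_pair.2 ⟨-b, a, rfl⟩, ?_⟩
    rw [map_add, map_add, map_smul, map_smul, h.J_J]
    module

/-- Holomorphic subspaces of all dimensions that contain a given vector `x` and are orthogonal to
a given vector `y`. -/
theorem exists_invariant_subspace {x y : V} (hx : x ≠ 0) (hxy : g x y = 0) (hJxy : g (J x) y = 0)
    {n : ℕ} (hn : 1 ≤ n) (hdim : 2 * n + 2 ≤ finrank ℝ V) :
    ∃ τ : Submodule ℝ V, finrank ℝ τ = 2 * n ∧ (∀ t ∈ τ, J t ∈ τ) ∧ x ∈ τ ∧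
      ∀ t ∈ τ, g t y = 0 := by
  induction n, hn using Nat.le_induction with
  | base =>
    obtain ⟨h1, h2⟩ := h.exists_sup_span (τ := ⊥) (z := x)
      (by rintro t rfl; rw [map_zero]; exact Submodule.zero_mem _) hx
      (by rintro t rfl; rw [map_zero])
    rw [bot_sup_eq] at h1 h2
    refine ⟨span ℝ {x, J x}, by rw [h1, finrank_bot], h2, subset_span (by simp), ?_⟩
    intro t ht
    obtain ⟨a, b, rfl⟩ := mem_span_pair.1 ht
    simp [hxy, hJxy]
  | succ k hk ih =>
    obtain ⟨τ, hτd, hτJ, hxτ, hτy⟩ := ih (by omega)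
    -- Orthogonality of `z` to `J y` as well as `y` makes `J z` orthogonal to `y`. The excluded
    -- space has dimension at most `2k + 2`, less than the available `2(k + 1) + 2`.
    obtain ⟨z, hz0, hz⟩ := exists_orthogonal g (τ ⊔ span ℝ {y, J y}) (by
      have h1 := Submodule.finrank_add_le_finrank_add_finrank τ (span ℝ {y, J y})
      have h2 : finrank ℝ (span ℝ {y, J y}) ≤ 2 := by
        classical
        have h3 := finrank_span_finset_le_card (R := ℝ) ({y, J y} : Finset V)
        rw [Finset.coe_pair] at h3
        exact h3.trans Finset.card_le_two
      omega)
    obtain ⟨h1, h2⟩ := h.exists_sup_span hτJ hz0 fun t ht ↦ hz t (mem_sup_left ht)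
    refine ⟨_, by rw [h1, hτd]; ring, h2, mem_sup_left hxτ, ?_⟩
    intro v hv
    obtain ⟨t, ht, w, hw, rfl⟩ := mem_sup.1 hv
    obtain ⟨a, b, rfl⟩ := mem_span_pair.1 hw
    have e1 : g z y = 0 := hz y (mem_sup_right (subset_span (by simp)))
    have e2 : g z (J y) = 0 := hz (J y) (mem_sup_right (subset_span (by simp)))
    simp [hτy t ht, e1, e2, h.inner_J_left]

end IsHermitianPair

/-! ### Anti-holomorphic pairs, and the comparison of `λ` with the sectional curvature. -/

namespace AlmostHermitianStructure

open Module Submodule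

set_option maxSynthPendingDepth 3

variable {E : Type*} [NormedAddCommGroup E] [NormedSpace ℝ E]
  {M : Type*} [TopologicalSpace M] [ChartedSpace E M] [IsManifold 𝓘(ℝ, E) ∞ M]
  (S : AlmostHermitianStructure E M)

/-- The metric on a tangent space as a bilinear map. -/
def innerₗ (p : M) :
    TangentSpace 𝓘(ℝ, E) p →ₗ[ℝ] TangentSpace 𝓘(ℝ, E) p →ₗ[ℝ] ℝ :=
  LinearMap.mk₂ ℝ (fun u v ↦ S.g.inner p u v)
    (fun u u' v ↦ by rw [map_add]; rfl) (fun r u v ↦ by rw [map_smul]; rfl)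
    (fun u v v' ↦ map_add _ _ _) (fun r u v ↦ map_smul _ _ _)

theorem isHermitianPair (p : M) : IsHermitianPair (S.innerₗ p) (S.J p).toLinearMap where
  symm := S.g.symm p
  pos := S.g.pos p
  J_J := S.J_J p
  inner_J_J := S.inner_J_J p

/-- `X` and `Y` are nonzero, orthogonal, and span an anti-holomorphic plane. -/
structure IsAntiholomorphicPair (p : M) (X Y : TangentSpace 𝓘(ℝ, E) p) : Prop where
  left_ne_zero : X ≠ 0
  right_ne_zero : Y ≠ 0
  inner_eq_zero : S.g.inner p X Y = 0
  inner_J_eq_zero : S.g.inner p (S.J p X) Y = 0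

variable {S}

theorem IsAntiholomorphicPair.symm {p : M} {X Y : TangentSpace 𝓘(ℝ, E) p}
    (h : S.IsAntiholomorphicPair p X Y) : S.IsAntiholomorphicPair p Y X := by
  refine ⟨h.right_ne_zero, h.left_ne_zero, (S.g.symm p Y X).trans h.inner_eq_zero, ?_⟩
  have h1 := (S.isHermitianPair p).inner_J_left Y X
  rw [(S.isHermitianPair p).symm Y] at h1
  exact h1.trans (neg_eq_zero.2 h.inner_J_eq_zero)

theorem IsAntiholomorphicPair.smul {p : M} {X Y : TangentSpace 𝓘(ℝ, E) p}
    (h : S.IsAntiholomorphicPair p X Y) {a b : ℝ} (ha : a ≠ 0) (hb : b ≠ 0) :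
    S.IsAntiholomorphicPair p (a • X) (b • Y) := by
  refine ⟨smul_ne_zero ha h.left_ne_zero, smul_ne_zero hb h.right_ne_zero, ?_, ?_⟩
  · change S.innerₗ p (a • X) (b • Y) = 0
    have : S.innerₗ p X Y = 0 := h.inner_eq_zero
    simp [this]
  · change S.innerₗ p ((S.J p).toLinearMap (a • X)) (b • Y) = 0
    have : S.innerₗ p ((S.J p).toLinearMap X) Y = 0 := h.inner_J_eq_zero
    rw [map_smul, map_smul, map_smul, LinearMap.smul_apply, this]
    simp

theorem IsAntiholomorphicPair.isAntiholomorphicPlane {p : M} {X Y : TangentSpace 𝓘(ℝ, E) p}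
    (h : S.IsAntiholomorphicPair p X Y) : S.IsAntiholomorphicPlane p (span ℝ {X, Y}) := by
  have hH := S.isHermitianPair p
  refine ⟨hH.finrank_span_pair h.left_ne_zero h.right_ne_zero h.inner_eq_zero, ?_⟩
  intro v hv w hw
  obtain ⟨a, b, rfl⟩ := mem_span_pair.1 hv
  obtain ⟨c, d, rfl⟩ := mem_span_pair.1 hw
  change S.innerₗ p ((S.J p).toLinearMap (a • X + b • Y)) (c • X + d • Y) = 0
  have h1 : S.innerₗ p ((S.J p).toLinearMap X) Y = 0 := h.inner_J_eq_zero
  have h2 : S.innerₗ p ((S.J p).toLinearMap Y) X = 0 := h.symm.inner_J_eq_zero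
  rw [map_add, map_smul, map_smul]
  simp only [map_add, map_smul, LinearMap.add_apply, LinearMap.smul_apply, h1, h2,
    hH.inner_J_self, smul_zero, add_zero]

theorem IsAntiholomorphicPlane.pair {p : M} {X Y : TangentSpace 𝓘(ℝ, E) p}
    (h : S.IsAntiholomorphicPlane p (span ℝ {X, Y})) (hXY : S.g.inner p X Y = 0) :
    S.IsAntiholomorphicPair p X Y := by
  have hle : ∀ Z : TangentSpace 𝓘(ℝ, E) p, finrank ℝ (span ℝ {Z}) ≤ 1 := fun Z ↦ by
    have h3 := finrank_span_finset_le_card (R := ℝ) ({Z} : Finset (TangentSpace 𝓘(ℝ, E) p))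
    rw [Finset.coe_singleton] at h3
    exact h3.trans (by simp)
  refine ⟨?_, ?_, hXY, h.2 X (subset_span (by simp)) Y (subset_span (by simp))⟩
  · rintro rfl
    have h1 := h.1
    rw [span_insert_zero] at h1
    have := hle Y
    omega
  · rintro rfl
    have h1 := h.1
    rw [Set.pair_comm, span_insert_zero] at h1
    have := hle X
    omega

theorem IsAntiholomorphicPlane.pair_of_orthonormal {p : M}
    {σ : Submodule ℝ (TangentSpace 𝓘(ℝ, E) p)} (h : S.IsAntiholomorphicPlane p σ)
    {X Y : TangentSpace 𝓘(ℝ, E) p} (hX : X ∈ σ) (hY : Y ∈ σ) (hXY : S.IsOrthonormalPair p X Y) :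
    S.IsAntiholomorphicPair p X Y := by
  refine ⟨?_, ?_, hXY.2.2, h.2 X hX Y hY⟩
  · rintro rfl
    have h1 : S.innerₗ p 0 0 = 1 := hXY.1
    simp at h1
  · rintro rfl
    have h1 : S.innerₗ p 0 0 = 1 := hXY.2.1
    simp at h1

variable [FiniteDimensional ℝ E]

theorem sectional_comm (p : M) (X Y : TangentSpace 𝓘(ℝ, E) p) :
    S.sectional p X Y = S.sectional p Y X := by
  rw [sectional, sectional, S.curvature_antisymm_left, S.curvature_antisymm_right, neg_neg]

theorem AxiomCoholomorphicSpheres.curvature_eq_zero {n : ℕ} (hS : S.AxiomCoholomorphicSpheres n)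
    {p : M} {σ : Submodule ℝ (TangentSpace 𝓘(ℝ, E) p)} (hσ : S.IsCoholomorphicPlane n p σ)
    {X Y Z ξ : TangentSpace 𝓘(ℝ, E) p} (hX : X ∈ σ) (hY : Y ∈ σ) (hZ : Z ∈ σ)
    (hξ : ∀ t ∈ σ, S.g.inner p t ξ = 0)
    (hXZ : S.g.inner p X Z = 0) (hYZ : S.g.inner p Y Z = 0) :
    S.curvature p X Y Z ξ = 0 := by
  -- Substituting `f q = p` turns the transport in the axiom into the identity, so `σ` becomes the
  -- tangent plane itself.
  obtain ⟨N, _, _, _, _, _, f, q, hf, rfl, rfl⟩ := hS p σ hσ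
  exact S.curvature_eq_zero_of_umbilical hf q hX hY hZ hξ hXZ hYZ

/-- Under the axiom of co-holomorphic spheres, `R(X, Y, JX, JY) = 0` for anti-holomorphic pairs. -/
theorem AxiomCoholomorphicSpheres.lam_eq_sectional {n : ℕ} (hS : S.AxiomCoholomorphicSpheres n)
    (hn : 1 ≤ n) (hdim : 2 * n + 2 ≤ finrank ℝ E)
    {p : M} {X Y : TangentSpace 𝓘(ℝ, E) p} (hXY : S.IsAntiholomorphicPair p X Y) :
    S.lam p X Y = S.sectional p X Y := by
  have hH := S.isHermitianPair p
  have : FiniteDimensional ℝ (TangentSpace 𝓘(ℝ, E) p) :=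
    inferInstanceAs (FiniteDimensional ℝ E)
  obtain ⟨τ, hτd, hτJ, hXτ, hτY⟩ := hH.exists_invariant_subspace hXY.left_ne_zero
    hXY.inner_eq_zero hXY.inner_J_eq_zero hn hdim
  have hσ : S.IsCoholomorphicPlane n p (τ ⊔ span ℝ {Y}) := by
    refine ⟨?_, τ, le_sup_left, hτd, ?_⟩
    · rw [hH.finrank_sup_of_orthogonal, hτd, finrank_span_singleton hXY.right_ne_zero]
      intro a ha b hb
      obtain ⟨r, rfl⟩ := mem_span_singleton.1 hb
      rw [map_smul, hτY a ha, smul_zero]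
    · refine le_antisymm (map_le_iff_le_comap.2 hτJ) fun t ht ↦ ?_
      refine ⟨-(S.J p).toLinearMap t, τ.neg_mem (hτJ t ht), ?_⟩
      rw [map_neg, hH.J_J, neg_neg]
  -- `JX` lies in `τ` and is orthogonal to `X` and `Y`. `JY` is normal: `g(t, JY) = -g(Jt, Y) = 0`
  -- for `t ∈ τ`, and `g(Y, JY) = 0`.
  have h0 := hS.curvature_eq_zero hσ (X := X) (Y := Y) (Z := S.J p X) (ξ := S.J p Y)
    (mem_sup_left hXτ) (mem_sup_right (mem_span_singleton_self Y)) (mem_sup_left (hτJ X hXτ))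
    (by
      intro v hv
      obtain ⟨t, ht, w, hw, rfl⟩ := mem_sup.1 hv
      obtain ⟨r, rfl⟩ := mem_span_singleton.1 hw
      have h1 := hH.inner_J_left t Y
      rw [hτY _ (hτJ t ht)] at h1
      change S.innerₗ p (t + r • Y) ((S.J p).toLinearMap Y) = 0
      rw [map_add, map_smul, LinearMap.add_apply, LinearMap.smul_apply, hH.inner_self_J,
        neg_eq_zero.1 h1.symm, smul_zero, add_zero])
    (hH.inner_self_J X) ((S.g.symm p _ _).trans hXY.inner_J_eq_zero)
  rw [lam, sectional, h0, sub_zero]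

theorem sectional_smul (p : M) (a b : ℝ) (X Y : TangentSpace 𝓘(ℝ, E) p) :
    S.sectional p (a • X) (b • Y) = a ^ 2 * b ^ 2 * S.sectional p X Y :=
  S.curvature_smul p a b X Y X Y

omit [FiniteDimensional ℝ E] in
theorem inner_normalize (p : M) {X : TangentSpace 𝓘(ℝ, E) p} {r : ℝ} (hr : 0 < r)
    (hX : S.g.inner p X X = r) :
    S.g.inner p ((√r)⁻¹ • X) ((√r)⁻¹ • X) = 1 := by
  have h1 : S.innerₗ p X X = r := hX
  change S.innerₗ p ((√r)⁻¹ • X) ((√r)⁻¹ • X) = 1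
  rw [map_smul, map_smul, LinearMap.smul_apply, h1, smul_eq_mul, smul_eq_mul, ← mul_assoc,
    ← mul_inv, Real.mul_self_sqrt hr.le, inv_mul_cancel₀ hr.ne']

/-- If `λ` and the sectional curvature agree on anti-holomorphic pairs, constant type implies
constant anti-holomorphic sectional curvature. -/
theorem IsPointwiseConstantType.isPointwiseConstantAntiholomorphic
    (hdim : 6 ≤ finrank ℝ E)
    (hlam : ∀ (p : M) (X Y : TangentSpace 𝓘(ℝ, E) p), S.IsAntiholomorphicPair p X Y →
      S.lam p X Y = S.sectional p X Y)
    (hT : S.IsPointwiseConstantType) : S.IsPointwiseConstantAntiholomorphic := by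
  intro p σ σ' hσ hσ' X hX Y hY X' hX' Y' hY' hXY hXY'
  have hH := S.isHermitianPair p
  have : FiniteDimensional ℝ (TangentSpace 𝓘(ℝ, E) p) :=
    inferInstanceAs (FiniteDimensional ℝ E)
  have hP := hσ.pair_of_orthonormal hX hY hXY
  have hP' := hσ'.pair_of_orthonormal hX' hY' hXY'
  have hstep : ∀ {A B C : TangentSpace 𝓘(ℝ, E) p}, S.IsAntiholomorphicPair p A B →
      S.IsAntiholomorphicPair p A C → S.g.inner p B B = S.g.inner p C C →
      S.sectional p A B = S.sectional p A C := fun {A B C} hB hC hBC ↦ by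
    rw [← hlam p A B hB, ← hlam p A C hC]
    exact hT p A B C hB.isAntiholomorphicPlane hC.isAntiholomorphicPlane hB.inner_eq_zero
      hC.inner_eq_zero hBC
  -- Four vectors cannot span a space of dimension at least 6, so some `z` forms an anti-holomorphic
  -- pair with both `X` and `X'`.
  obtain ⟨z, hz0, hz⟩ := IsHermitianPair.exists_orthogonal (S.innerₗ p)
    (span ℝ {X, S.J p X, X', S.J p X'}) (by
      classical
      have h3 := finrank_span_finset_le_card (R := ℝ)
        ({X, S.J p X, X', S.J p X'} : Finset (TangentSpace 𝓘(ℝ, E) p))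
      push_cast at h3
      rw [Set.finrank] at h3
      have h4 : finrank ℝ (TangentSpace 𝓘(ℝ, E) p) = finrank ℝ E := rfl
      have h5 := Finset.card_le_four (a := X) (b := S.J p X) (c := X') (d := S.J p X')
      omega)
  have hzz : 0 < S.g.inner p z z := S.g.pos p z hz0
  have hr : (√(S.g.inner p z z))⁻¹ ≠ 0 := inv_ne_zero (Real.sqrt_pos.2 hzz).ne'
  have hmem : ∀ W ∈ ({X, S.J p X, X', S.J p X'} : Set (TangentSpace 𝓘(ℝ, E) p)),
      S.g.inner p W z = 0 := fun W hW ↦ (S.g.symm p W z).trans (hz W (subset_span hW))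
  have hXz : S.IsAntiholomorphicPair p X ((√(S.g.inner p z z))⁻¹ • z) := by
    simpa using IsAntiholomorphicPair.smul (a := 1)
      ⟨hP.left_ne_zero, hz0, hmem X (by simp), hmem _ (by simp)⟩ one_ne_zero hr
  have hXz' : S.IsAntiholomorphicPair p X' ((√(S.g.inner p z z))⁻¹ • z) := by
    simpa using IsAntiholomorphicPair.smul (a := 1)
      ⟨hP'.left_ne_zero, hz0, hmem X' (by simp), hmem _ (by simp)⟩ one_ne_zero hr
  have hunit := inner_normalize (S := S) p hzz rfl
  -- With `z` normalized, the chain is `K(X, Y) = K(X, z) = K(z, X) = K(z, X') = K(X', z) = K(X',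
  -- Y')`; each use of `hstep` keeps the first vector and replaces the second by one of equal
  -- length.
  rw [hstep hP hXz (hXY.2.1.trans hunit.symm), sectional_comm,
    hstep hXz.symm hXz'.symm (hXY.1.trans hXY'.1.symm), sectional_comm,
    hstep hXz' hP' (hunit.trans hXY'.2.1.symm)]

/-- If `λ` and the sectional curvature agree on anti-holomorphic pairs, constant anti-holomorphic
sectional curvature implies constant type. -/
theorem IsPointwiseConstantAntiholomorphic.isPointwiseConstantType
    (hlam : ∀ (p : M) (X Y : TangentSpace 𝓘(ℝ, E) p), S.IsAntiholomorphicPair p X Y →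
      S.lam p X Y = S.sectional p X Y)
    (hA : S.IsPointwiseConstantAntiholomorphic) : S.IsPointwiseConstantType := by
  intro p X Y Z hXY hXZ h1 h2 h3
  have hP := hXY.pair h1
  have hP' := hXZ.pair h2
  rw [hlam p X Y hP, hlam p X Z hP']
  have hX0 : 0 < S.g.inner p X X := S.g.pos p X hP.left_ne_zero
  have hY0 : 0 < S.g.inner p Y Y := S.g.pos p Y hP.right_ne_zero
  have hr : (√(S.g.inner p X X))⁻¹ ≠ 0 := inv_ne_zero (Real.sqrt_pos.2 hX0).ne'
  have hs : (√(S.g.inner p Y Y))⁻¹ ≠ 0 := inv_ne_zero (Real.sqrt_pos.2 hY0).ne'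
  -- As `Y` and `Z` have the same length, one pair of factors normalizes both `(X, Y)` and `(X, Z)`;
  -- the common factor is cancelled at the end.
  have hQ := hP.smul hr hs
  have hQ' := hP'.smul hr hs
  have h := hA p _ _ hQ.isAntiholomorphicPlane hQ'.isAntiholomorphicPlane
    _ (subset_span (by simp)) _ (subset_span (by simp))
    _ (subset_span (by simp)) _ (subset_span (by simp))
    ⟨inner_normalize p hX0 rfl, inner_normalize p hY0 rfl, hQ.inner_eq_zero⟩
    ⟨inner_normalize p hX0 rfl, inner_normalize p hY0 h3.symm, hQ'.inner_eq_zero⟩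
  rw [sectional_smul, sectional_smul] at h
  exact mul_left_cancel₀ (mul_ne_zero (pow_ne_zero 2 hr) (pow_ne_zero 2 hs)) h

end AlmostHermitianStructure
end

theorem theorem4p1 {E : Type*} [NormedAddCommGroup E] [NormedSpace ℝ E] [FiniteDimensional ℝ E]
    {M : Type*} [TopologicalSpace M] [ChartedSpace E M] [IsManifold 𝓘(ℝ, E) ∞ M]
    (m : ℕ) (hdim : Module.finrank ℝ E = 2 * m) (hm : 3 ≤ m)
    (S : AlmostHermitianStructure E M)
    (n : ℕ) (hn : 1 ≤ n) (hnm : n ≤ m - 1)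
    (hS : S.AxiomCoholomorphicSpheres n) :
    (S.IsPointwiseConstantType ↔ S.IsPointwiseConstantAntiholomorphic) ∧
    ∀ α : M → ℝ,
      S.IsPointwiseConstantTypeWith α ↔ S.IsPointwiseConstantAntiholomorphicWith α := by
  have hlam : ∀ (p : M) (X Y : TangentSpace 𝓘(ℝ, E) p), S.IsAntiholomorphicPair p X Y →
      S.lam p X Y = S.sectional p X Y :=
    -- `n ≤ m - 1` gives `2n + 2 ≤ 2m`, the room needed for a holomorphic `2n`-plane orthogonal to
    -- `Y` and `JY`.
    fun p X Y h ↦ hS.lam_eq_sectional hn (by omega) h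
  refine ⟨⟨fun h ↦ h.isPointwiseConstantAntiholomorphic (by omega) hlam,
    fun h ↦ h.isPointwiseConstantType hlam⟩, fun α ↦ ⟨fun h ↦ ?_, fun h ↦ ⟨?_, ?_⟩⟩⟩
  · intro p σ hσ X hX Y hY hXY
    have hP := hσ.pair_of_orthonormal hX hY hXY
    rw [← hlam p X Y hP, h.2 p X Y hP.isAntiholomorphicPlane hXY]
  -- A prescribed value `α p` makes the sectional curvatures of any two anti-holomorphic planes at
  -- `p` agree, so the version without `α` supplies constant type.
  · refine AlmostHermitianStructure.IsPointwiseConstantAntiholomorphic.isPointwiseConstantType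
      hlam ?_
    intro p σ σ' hσ hσ' X hX Y hY X' hX' Y' hY' hXY hXY'
    rw [h p σ hσ X hX Y hY hXY, h p σ' hσ' X' hX' Y' hY' hXY']
  · intro p X Y hσ hXY
    rw [hlam p X Y (hσ.pair hXY.2.2)]
    exact h p _ hσ X (Submodule.subset_span (by simp)) Y (Submodule.subset_span (by simp)) hXY
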